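/- For a topological space $X$, the \emph{deck} of $X$ is the set $\{[X\setminus\{x\}] : x\in X\}$, where $[W]$ denotes the homeomorphism class of $W$. The space $X$ is \emph{reconstructible} if every topological space with the same deck as $X$ is homeomorphic to $X$; it is \emph{$h$-homogeneous} if every non-empty clopen subset of $X$ is homeomorphic to $X$. Let $C_1(X)$ be the set of all $x\in X$ such that the connected component of $x$ in $X$ is $\{x\}$. There is a compact metrizable space $X$ such that $C_1(X)$ is a dense $G_\delta$ subset of $X$ with dense complement, but $X$ is reconstructible. Moreover, $X$ can be taken to be a topological sum $X=Y\oplus Z$, where $Y$ and $Z$ are non-homeomorphic compact metrizable spaces, both are $h$-homogeneous and non-reconstructible, and neither is homeomorphic to the Cantor set. -/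

import Mathlib

open Topology

universe u

namespace TopRecon

/-- A card of `X` is any space homeomorphic to `X ∖ {x}` for some point `x` of `X`. -/
def IsCard (Y X : Type u) [TopologicalSpace Y] [TopologicalSpace X] : Prop :=
  ∃ x : X, Nonempty (Y ≃ₜ ↥({x}ᶜ : Set X))

/-- `Z` is a reconstruction of `X` if both have the same cards, that is, the same deck: the sets
of homeomorphism classes of their one-point deletions are equal. -/
def IsReconstruction (Z X : Type u) [TopologicalSpace Z] [TopologicalSpace X] : Prop :=
  ∀ (Y : Type u) [TopologicalSpace Y], IsCard Y Z ↔ IsCard Y X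

/-- `X` is (topologically) reconstructible if every topological space with the same deck is
homeomorphic to `X`. No separation axiom is imposed on `Z`. Letting `Z` range over the universe of
`X` is no restriction: a space with the same deck as `X` has the cardinality of some
`X ∖ {x}` plus one point (or is empty), so it has a homeomorphic copy in that universe. -/
def Reconstructible (X : Type u) [TopologicalSpace X] : Prop :=
  ∀ (Z : Type u) [TopologicalSpace Z], IsReconstruction Z X → Nonempty (Z ≃ₜ X)

/-- `C₁ X` is the set of the points of `X` whose connected component is a single point. -/
def C₁ (X : Type u) [TopologicalSpace X] : Set X :=
  {x | connectedComponent x = {x}}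

/-- `X` is h-homogeneous if each of its non-empty clopen subsets is homeomorphic to `X`. -/
def HHomogeneous (X : Type u) [TopologicalSpace X] : Prop :=
  ∀ U : Set X, IsClopen U → U.Nonempty → Nonempty (U ≃ₜ X)

end TopRecon

/-! Take `L` compact metrizable with dense isolated points and a non-trivial component. In `ℕ → L`,
fixing an initial block of coordinates at isolated points gives a clopen copy of the whole power,
and such copies lie in every non-empty open set. This self-similarity gives h-homogeneity
(`hHomogeneous_of_forall_isOpen`). Sequences of isolated points are singleton components, and one
coordinate placed in a non-trivial component destroys this, so `C₁` and its complement are both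
dense.

Such a power `X` is not reconstructible: for `y ∈ C₁ X` and `x ≠ y`, also deleting `y` from `X ∖
{x}` changes nothing up to homeomorphism (`nonempty_homeomorph_compl_pair`), so the non-compact
space `X ∖ {y}` has the deck of `X`.

The sum `Y ⊕ Z` of two non-homeomorphic spaces of this kind is reconstructible. A compact Hausdorff
reconstruction is determined by one card. A non-compact one would, by the card that deletes a point
of `C₁ Y`, have a non-compact clopen set made of pieces of `Y`, and the card at a point of `C₁ Z`
would force a compact open part of it to be made of `Z`. By h-homogeneity that part is homeomorphic
to both `Y` and `Z` (`reconstructible_sum`).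

The two powers come from `L` with remainder an arc or a topologist's sine curve. They differ because
all components of the first are path connected and some component of the second is not. -/

namespace TopRecon

open Set Filter Function

/-! ### Gluing homeomorphisms along open partitions -/

/-- The union of a disjoint family of open sets is their topological sum. -/
theorem nonempty_sigma_homeomorph_iUnion {ι X : Type*} [TopologicalSpace X] {C : ι → Set X}
    (hC : ∀ i, IsOpen (C i)) (hd : Pairwise (Disjoint on C)) :
    Nonempty ((Σ i, C i) ≃ₜ (⋃ i, C i : Set X)) := by
  let f : (Σ i, C i) → (⋃ i, C i : Set X) := fun p => ⟨p.2, mem_iUnion.2 ⟨p.1, p.2.2⟩⟩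
  have hval : IsOpenMap (fun p : (Σ i, C i) => (p.2 : X)) :=
    isOpenMap_sigma.2 fun i => (hC i).isOpenMap_subtype_val
  have hcont : Continuous (fun p : (Σ i, C i) => (p.2 : X)) :=
    continuous_sigma fun i => continuous_subtype_val
  have hf : Bijective f := by
    constructor
    · rintro ⟨i, x, hx⟩ ⟨j, y, hy⟩ h
      obtain rfl : x = y := congrArg Subtype.val h
      obtain rfl : i = j := by
        by_contra hij
        exact disjoint_left.1 (hd hij) hx hy
      rfl
    · rintro ⟨x, hx⟩
      obtain ⟨i, hi⟩ := mem_iUnion.1 hx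
      exact ⟨⟨i, x, hi⟩, rfl⟩
  refine ⟨(Equiv.ofBijective f hf).toHomeomorphOfContinuousOpen
    (hcont.subtype_mk _) fun U hU => ?_⟩
  refine ⟨_, hval U hU, ?_⟩
  ext x
  constructor
  · rintro ⟨p, hp, hpx⟩
    exact ⟨p, hp, Subtype.ext hpx⟩
  · rintro ⟨p, hp, rfl⟩
    exact ⟨p, hp, rfl⟩

theorem nonempty_homeomorph_iUnion {ι X Y : Type*} [TopologicalSpace X] [TopologicalSpace Y]
    {C : ι → Set X} {D : ι → Set Y} (hC : ∀ i, IsOpen (C i)) (hD : ∀ i, IsOpen (D i))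
    (hCd : Pairwise (Disjoint on C)) (hDd : Pairwise (Disjoint on D))
    (h : ∀ i, Nonempty (C i ≃ₜ D i)) :
    Nonempty ((⋃ i, C i : Set X) ≃ₜ (⋃ i, D i : Set Y)) := by
  obtain ⟨a⟩ := nonempty_sigma_homeomorph_iUnion hC hCd
  obtain ⟨b⟩ := nonempty_sigma_homeomorph_iUnion hD hDd
  have e := fun i => (h i).some
  let g : (Σ i, C i) ≃ₜ (Σ i, D i) :=
    { toEquiv := Equiv.sigmaCongrRight fun i => (e i).toEquiv
      continuous_toFun := continuous_sigma fun i => continuous_sigmaMk.comp (e i).continuous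
      continuous_invFun := continuous_sigma fun i => continuous_sigmaMk.comp (e i).symm.continuous }
  exact ⟨(a.symm.trans g).trans b⟩

theorem nonempty_homeomorph_union {X Y : Type*} [TopologicalSpace X] [TopologicalSpace Y]
    {A B : Set X} {A' B' : Set Y} (hA : IsOpen A) (hB : IsOpen B) (hA' : IsOpen A')
    (hB' : IsOpen B') (hAB : Disjoint A B) (hAB' : Disjoint A' B')
    (h₁ : Nonempty (A ≃ₜ A')) (h₂ : Nonempty (B ≃ₜ B')) :
    Nonempty ((A ∪ B : Set X) ≃ₜ (A' ∪ B' : Set Y)) := by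
  have key := nonempty_homeomorph_iUnion (C := fun b : Bool => cond b A B)
    (D := fun b : Bool => cond b A' B') (by simp [hA, hB]) (by simp [hA', hB'])
    (pairwise_disjoint_on_bool.2 hAB) (pairwise_disjoint_on_bool.2 hAB')
    (by rintro (_ | _) <;> assumption)
  rwa [← union_eq_iUnion, ← union_eq_iUnion] at key

/-- The successive differences of a decreasing sequence of sets. -/
theorem iUnion_diff_succ {X : Type*} {S : ℕ → Set X} (hS : ∀ n, S (n + 1) ⊆ S n) :
    ⋃ n, S n \ S (n + 1) = S 0 \ ⋂ n, S n := by
  have hanti := antitone_nat_of_succ_le hS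
  ext x
  simp only [mem_iUnion, Set.mem_sdiff, mem_iInter, not_forall]
  constructor
  · rintro ⟨n, h₁, h₂⟩
    exact ⟨hanti (Nat.zero_le n) h₁, n + 1, h₂⟩
  · rintro ⟨h₀, n, hn⟩
    induction n with
    | zero => exact absurd h₀ hn
    | succ k ih =>
      by_cases hk : x ∈ S k
      · exact ⟨k, hk, hn⟩
      · exact ih hk

theorem pairwise_disjoint_diff_succ {X : Type*} {S : ℕ → Set X} (hS : ∀ n, S (n + 1) ⊆ S n) :
    Pairwise (Disjoint on fun n => S n \ S (n + 1)) := by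
  have hanti := antitone_nat_of_succ_le hS
  refine (pairwise_disjoint_on _).2 fun m n hmn => disjoint_left.2 fun x h₁ h₂ => ?_
  exact h₁.2 (hanti hmn h₂.1)

/-- Two compact Hausdorff spaces with homeomorphic one-point deletions are homeomorphic. -/
theorem nonempty_homeomorph_of_compl {X Y : Type*} [TopologicalSpace X] [TopologicalSpace Y]
    [CompactSpace X] [T2Space X] [CompactSpace Y] [T2Space Y] {x : X} {y : Y}
    (h : Nonempty (({x}ᶜ : Set X) ≃ₜ ({y}ᶜ : Set Y))) : Nonempty (X ≃ₜ Y) := by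
  obtain ⟨e⟩ := h
  -- Both spaces are the one-point compactification of the same deletion.
  have h₁ := OnePoint.equivOfIsEmbeddingOfRangeEq x (Subtype.val : ({x}ᶜ : Set X) → X)
    IsEmbedding.subtypeVal Subtype.range_coe
  have h₂ := OnePoint.equivOfIsEmbeddingOfRangeEq y
    ((Subtype.val : ({y}ᶜ : Set Y) → Y) ∘ e) (IsEmbedding.subtypeVal.comp e.isEmbedding)
    (by rw [range_comp, e.surjective.range_eq, image_univ, Subtype.range_coe])
  exact ⟨h₁.symm.trans h₂⟩

theorem nonempty_homeomorph_compl_val {X : Type*} [TopologicalSpace X] {A B : Set X}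
    (hAB : A ⊆ B) : Nonempty ((Subtype.val ⁻¹' A : Set B) ≃ₜ A) := by
  have h := IsEmbedding.subtypeVal.homeomorphImage (Subtype.val ⁻¹' A : Set B)
  exact ⟨h.trans (Homeomorph.setCongr (by simpa using hAB))⟩

theorem nonempty_homeomorph_diff_singleton {X : Type*} [TopologicalSpace X] {A : Set X} (p : A) :
    Nonempty (({p}ᶜ : Set A) ≃ₜ (A \ {(p : X)} : Set X)) := by
  obtain ⟨e⟩ := nonempty_homeomorph_compl_val (sdiff_subset : A \ {(p : X)} ⊆ A)
  exact ⟨(Homeomorph.setCongr (by ext q; simp [Subtype.ext_iff])).trans e⟩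

/-! ### A criterion for h-homogeneity -/

/-- A compact metrizable space each of whose non-empty open sets contains a clopen copy of the
whole space is h-homogeneous. -/
theorem hHomogeneous_of_forall_isOpen {X : Type u} [TopologicalSpace X] [CompactSpace X]
    [TopologicalSpace.MetrizableSpace X]
    (h : ∀ U : Set X, IsOpen U → U.Nonempty → ∃ e : X → X, IsOpenEmbedding e ∧ range e ⊆ U) :
    HHomogeneous X := by
  let := TopologicalSpace.metrizableSpaceMetric X
  rintro A hA ⟨a, ha⟩
  let E := {e : X → X // IsOpenEmbedding e}
  have step : ∀ (n : ℕ) (e : E), ∃ e' : E,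
      range e'.1 ⊆ e.1 '' A ∩ Metric.ball (e.1 a) (1 / ((n : ℝ) + 1)) := by
    intro n e
    obtain ⟨e', he', hr⟩ := h (e.1 '' A ∩ Metric.ball (e.1 a) (1 / ((n : ℝ) + 1)))
      ((e.2.isOpenMap _ hA.isOpen).inter Metric.isOpen_ball)
      ⟨e.1 a, mem_image_of_mem _ ha, Metric.mem_ball_self (by positivity)⟩
    exact ⟨⟨e', he'⟩, hr⟩
  choose next hnext using step
  -- Nested copies `S n` of `X` and `T n` of `A` with `S (n + 1) ⊆ T n ⊆ S n`, shrinking to one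
  -- point `p`. Starting from `id` makes `S 0` all of `X` and `T 0 = A`.
  let e : ℕ → E := fun n => Nat.rec ⟨id, IsOpenEmbedding.id⟩ (fun n e => next n e) n
  have he : ∀ n, range (e (n + 1)).1 ⊆
      (e n).1 '' A ∩ Metric.ball ((e n).1 a) (1 / ((n : ℝ) + 1)) := fun n => hnext n (e n)
  let S : ℕ → Set X := fun n => range (e n).1
  let T : ℕ → Set X := fun n => (e n).1 '' A
  have hTS : ∀ n, T n ⊆ S n := fun n => image_subset_range _ _
  have hST : ∀ n, S (n + 1) ⊆ T n := fun n => (he n).trans inter_subset_left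
  have hSS : ∀ n, S (n + 1) ⊆ S n := fun n => (hST n).trans (hTS n)
  have hTT : ∀ n, T (n + 1) ⊆ T n := fun n => (hTS (n + 1)).trans (hST n)
  have hSc : ∀ n, IsClosed (S n) := fun n => (isCompact_range (e n).2.continuous).isClosed
  have hTc : ∀ n, IsClosed (T n) := fun n =>
    (hA.isClosed.isCompact.image (e n).2.continuous).isClosed
  have hSo : ∀ n, IsOpen (S n) := fun n => (e n).2.isOpen_range
  have hTo : ∀ n, IsOpen (T n) := fun n => (e n).2.isOpenMap _ hA.isOpen
  obtain ⟨p, hp⟩ : (⋂ n, S n).Nonempty :=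
    IsCompact.nonempty_iInter_of_sequence_nonempty_isCompact_isClosed S hSS
      (fun n => ⟨_, mem_range_self a⟩) (hSc 0).isCompact hSc
  have hSp : ⋂ n, S n = {p} := by
    refine Subset.antisymm (fun q hq => ?_) (singleton_subset_iff.2 hp)
    rw [mem_iInter] at hp hq
    refine dist_le_zero.1 (le_of_forall_pos_le_add fun ε hε => ?_)
    obtain ⟨n, hn⟩ := exists_nat_one_div_lt (half_pos hε)
    have h₁ := Metric.mem_ball.1 (he n (hp (n + 1))).2
    have h₂ := Metric.mem_ball.1 (he n (hq (n + 1))).2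
    have := dist_triangle_right q p ((e n).1 a)
    linarith
  have hTp : ⋂ n, T n = {p} := by
    rw [← hSp]
    refine Subset.antisymm (iInter_mono hTS) (subset_iInter fun n => ?_)
    exact (iInter_subset S (n + 1)).trans (hST n)
  have hS0 : S 0 = univ := range_id
  have hT0 : T 0 = A := image_id A
  have hpA : p ∈ A := by
    rw [← hT0]
    exact iInter_subset T 0 (hTp ▸ mem_singleton p)
  -- Both differences contain `T n \ S (n + 1)`. What is left is `S m \ T m`, with `m = n + 1` on
  -- one side and `m = n` on the other, and this is a copy of `Aᶜ` for every `m`.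
  have hpiece : ∀ n, Nonempty ((T n \ T (n + 1) : Set X) ≃ₜ (S n \ S (n + 1) : Set X)) := by
    intro n
    have h₁ : T n \ T (n + 1) = (T n \ S (n + 1)) ∪ (S (n + 1) \ T (n + 1)) :=
      (sdiff_union_sdiff_cancel (hST n) (hTS (n + 1))).symm
    have h₂ : S n \ S (n + 1) = (T n \ S (n + 1)) ∪ (S n \ T n) := by
      rw [union_comm]
      exact (sdiff_union_sdiff_cancel (hTS n) (hST n)).symm
    have h₃ : ∀ m, Nonempty ((S m \ T m : Set X) ≃ₜ (Aᶜ : Set X)) := fun m => by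
      have := (e m).2.isEmbedding.homeomorphImage Aᶜ
      refine ⟨((Homeomorph.setCongr ?_).trans this.symm)⟩
      change range (e m).1 \ (e m).1 '' A = _
      rw [← image_univ, ← image_sdiff (e m).2.injective, compl_eq_univ_sdiff]
    rw [h₁, h₂]
    refine nonempty_homeomorph_union ((hTo n).sdiff (hSc (n + 1)))
      ((hSo (n + 1)).sdiff (hTc (n + 1))) ((hTo n).sdiff (hSc (n + 1)))
      ((hSo n).sdiff (hTc n)) ?_ ?_ ⟨Homeomorph.refl _⟩ ?_
    · exact disjoint_left.2 fun x hx hx' => hx.2 hx'.1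
    · exact disjoint_left.2 fun x hx hx' => hx'.2 hx.1
    · exact ⟨(h₃ (n + 1)).some.trans (h₃ n).some.symm⟩
  have key := nonempty_homeomorph_iUnion (fun n => (hTo n).sdiff (hTc (n + 1)))
    (fun n => (hSo n).sdiff (hSc (n + 1))) (pairwise_disjoint_diff_succ hTT)
    (pairwise_disjoint_diff_succ hSS) hpiece
  -- The glued pieces give `A \ {p} ≃ₜ X \ {p}`, and compactness restores `p`.
  rw [iUnion_diff_succ hTT, iUnion_diff_succ hSS, hTp, hSp, hT0, hS0,
    ← compl_eq_univ_sdiff] at key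
  have : CompactSpace A := isCompact_iff_compactSpace.1 hA.isClosed.isCompact
  obtain ⟨k⟩ := nonempty_homeomorph_diff_singleton (⟨p, hpA⟩ : A)
  exact nonempty_homeomorph_of_compl ⟨k.trans key.some⟩

theorem HHomogeneous.nonempty_homeomorph {X : Type u} [TopologicalSpace X] (h : HHomogeneous X)
    {A B : Set X} (hA : IsClopen A) (hB : IsClopen B) (hA' : A.Nonempty) (hB' : B.Nonempty) :
    Nonempty (A ≃ₜ B) :=
  ⟨(h A hA hA').some.trans (h B hB hB').some.symm⟩

/-! ### Singleton components and clopen neighbourhoods -/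

/-- In a compact Hausdorff space components are quasi-components, so the clopen neighbourhoods of
`x` form a directed family with intersection `{x}`; by compactness one of them fits into `U`. -/
theorem exists_isClopen_of_mem_C₁ {X : Type u} [TopologicalSpace X] [CompactSpace X] [T2Space X]
    {x : X} (hx : x ∈ C₁ X) {U : Set X} (hU : U ∈ 𝓝 x) : ∃ V, IsClopen V ∧ x ∈ V ∧ V ⊆ U := by
  have hx' : (⋂ s : {s : Set X // IsClopen s ∧ x ∈ s}, (s : Set X)) = {x} := by
    rw [← connectedComponent_eq_iInter_isClopen]
    exact hx
  have : Nonempty {s : Set X // IsClopen s ∧ x ∈ s} := ⟨⟨univ, isClopen_univ, mem_univ x⟩⟩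
  have hdir : Directed (· ⊇ ·) fun s : {s : Set X // IsClopen s ∧ x ∈ s} => (s : Set X) := by
    rintro ⟨s, hs, hxs⟩ ⟨t, ht, hxt⟩
    exact ⟨⟨s ∩ t, hs.inter ht, hxs, hxt⟩, inter_subset_left, inter_subset_right⟩
  obtain ⟨⟨V, hV, hxV⟩, hVU⟩ := exists_subset_nhds_of_isCompact hdir
    (fun s => s.2.1.isClosed.isCompact) (U := U) (by simpa [hx'] using hU)
  exact ⟨V, hV, hxV, hVU⟩

theorem mem_C₁_of_forall {X : Type u} [TopologicalSpace X] [T1Space X] {x : X}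
    (h : ∀ U ∈ 𝓝 x, ∃ V, IsClopen V ∧ x ∈ V ∧ V ⊆ U) : x ∈ C₁ X := by
  refine Subset.antisymm (fun y hy => ?_) (singleton_subset_iff.2 mem_connectedComponent)
  by_contra hyx
  obtain ⟨V, hV, hxV, hVy⟩ := h {y}ᶜ (isOpen_compl_singleton.mem_nhds (Ne.symm hyx))
  exact hVy (hV.connectedComponent_subset hxV hy) rfl

/-- `C₁ X` consists of the points with arbitrarily small clopen neighbourhoods, and for each bound
on the diameter the union of the small clopen sets is open. -/
theorem isGδ_C₁ {X : Type u} [TopologicalSpace X] [CompactSpace X]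
    [TopologicalSpace.MetrizableSpace X] : IsGδ (C₁ X) := by
  let := TopologicalSpace.metrizableSpaceMetric X
  have : C₁ X = ⋂ n : ℕ, ⋃₀ {V | IsClopen V ∧ ∀ a ∈ V, ∀ b ∈ V, dist a b < 1 / ((n : ℝ) + 1)} := by
    ext x
    simp only [mem_iInter, mem_sUnion, mem_ofPred_eq]
    constructor
    · intro hx n
      obtain ⟨V, hV, hxV, hVb⟩ := exists_isClopen_of_mem_C₁ hx
        (Metric.ball_mem_nhds x (half_pos (by positivity : 0 < 1 / ((n : ℝ) + 1))))
      refine ⟨V, ⟨hV, fun a ha b hb => ?_⟩, hxV⟩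
      have h₁ := Metric.mem_ball.1 (hVb ha)
      have h₂ := Metric.mem_ball.1 (hVb hb)
      have := dist_triangle_right a b x
      linarith
    · intro h
      refine mem_C₁_of_forall fun U hU => ?_
      obtain ⟨ε, hε, hU⟩ := Metric.mem_nhds_iff.1 hU
      obtain ⟨n, hn⟩ := exists_nat_one_div_lt hε
      obtain ⟨V, ⟨hV, hd⟩, hxV⟩ := h n
      exact ⟨V, hV, hxV, fun a ha => hU (Metric.mem_ball.2 ((hd a ha x hxV).trans hn))⟩
  rw [this]
  exact .iInter fun n => (isOpen_sUnion fun V hV => hV.1.isOpen).isGδ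

theorem HHomogeneous.not_isOpen_singleton {X : Type u} [TopologicalSpace X] [T1Space X]
    [Nontrivial X] (h : HHomogeneous X) (x : X) : ¬ IsOpen ({x} : Set X) := by
  intro hx
  obtain ⟨e⟩ := h {x} ⟨isClosed_singleton, hx⟩ (singleton_nonempty x)
  obtain ⟨a, b, hab⟩ := exists_pair_ne X
  exact hab (e.symm.injective (Subsingleton.elim _ _))

/-! ### Non-reconstructibility of h-homogeneous spaces -/

/-- In a compact h-homogeneous space whose singleton components are dense, every point is the limit
of a disjoint sequence of non-empty clopen sets. -/
theorem exists_seq_isClopen {X : Type u} [MetricSpace X] [CompactSpace X] [Nontrivial X]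
    (hh : HHomogeneous X) (hd : Dense (C₁ X)) (x : X) {O : Set X} (hO : O ∈ 𝓝 x) :
    ∃ B : ℕ → Set X, (∀ n, IsClopen (B n)) ∧ (∀ n, (B n).Nonempty) ∧ (∀ n, x ∉ B n) ∧
      (∀ n, B n ⊆ O) ∧ (∀ n, B n ⊆ Metric.ball x (1 / ((n : ℝ) + 1))) ∧
      Pairwise (Disjoint on B) := by
  have small : ∀ N ∈ 𝓝 x, ∃ B, IsClopen B ∧ B.Nonempty ∧ x ∉ B ∧ B ⊆ N := by
    intro N hN
    have : (interior N \ {x}).Nonempty := by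
      by_contra hne
      rw [not_nonempty_iff_eq_empty, sdiff_eq_empty] at hne
      refine hh.not_isOpen_singleton x ?_
      have : interior N = {x} :=
        Subset.antisymm hne (singleton_subset_iff.2 (mem_interior_iff_mem_nhds.2 hN))
      exact this ▸ isOpen_interior
    have ho : IsOpen (interior N \ {x}) := isOpen_interior.sdiff isClosed_singleton
    obtain ⟨c, hc, hcC⟩ := hd.inter_open_nonempty _ ho this
    obtain ⟨V, hV, hcV, hVN⟩ := exists_isClopen_of_mem_C₁ hcC (ho.mem_nhds hc)
    exact ⟨V, hV, ⟨c, hcV⟩, fun hx => (hVN hx).2 rfl,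
      (hVN.trans sdiff_subset).trans interior_subset⟩
  -- Each set carries an integer recording its radius. These integers increase strictly, so the
  -- `n`-th is at least `n`.
  obtain ⟨f, hf, hr⟩ := exists_seq_of_forall_finset_exists
    (fun p : ℕ × Set X => IsClopen p.2 ∧ p.2.Nonempty ∧ x ∉ p.2 ∧ p.2 ⊆ O ∧
      p.2 ⊆ Metric.ball x (1 / ((p.1 : ℝ) + 1)))
    (fun p q => p.1 < q.1 ∧ Disjoint p.2 q.2) (by
      intro s hs
      obtain ⟨B, hB, hBn, hxB, hBN⟩ := small
        ((O ∩ Metric.ball x (1 / (((s.sup Prod.fst + 1 : ℕ) : ℝ) + 1))) ∩ ⋂ p ∈ s, p.2ᶜ)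
        (inter_mem (inter_mem hO (Metric.ball_mem_nhds x (by positivity)))
          ((biInter_finset_mem s).2 fun p hp =>
            (hs p hp).1.compl.isOpen.mem_nhds (hs p hp).2.2.1))
      refine ⟨(s.sup Prod.fst + 1, B), ⟨hB, hBn, hxB, fun b hb => (hBN hb).1.1,
        fun b hb => (hBN hb).1.2⟩, fun p hp => ⟨Nat.lt_succ_of_le (Finset.le_sup hp), ?_⟩⟩
      exact disjoint_right.2 fun b hb => mem_iInter₂.1 (hBN hb).2 p hp)
  have hmono : StrictMono fun n => (f n).1 := fun m n hmn => (hr m n hmn).1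
  refine ⟨fun n => (f n).2, fun n => (hf n).1, fun n => (hf n).2.1, fun n => (hf n).2.2.1,
    fun n => (hf n).2.2.2.1, fun n => (hf n).2.2.2.2.trans (Metric.ball_subset_ball ?_),
    (pairwise_disjoint_on _).2 fun m n hmn => (hr m n hmn).2⟩
  have : (n : ℝ) ≤ (f n).1 := by exact_mod_cast hmono.id_le n
  gcongr

/-- The union of a sequence of closed sets converging to a point, together with that point,
is closed. -/
theorem isClosed_insert_iUnion {X : Type u} [MetricSpace X] {x : X} {B : ℕ → Set X}
    (hB : ∀ n, IsClosed (B n)) (hb : ∀ n, B n ⊆ Metric.ball x (1 / ((n : ℝ) + 1))) :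
    IsClosed (insert x (⋃ n, B n)) := by
  -- For each `N`, all but finitely many `B n` lie in the `N`-th closed ball.
  have : insert x (⋃ n, B n) =
      ⋂ N : ℕ, (Metric.closedBall x (1 / ((N : ℝ) + 1)) ∪ ⋃ n ∈ Finset.range N, B n) := by
    ext z
    simp only [mem_insert_iff, mem_iUnion, mem_iInter, mem_union, Finset.mem_range, exists_prop]
    constructor
    · rintro (rfl | ⟨n, hn⟩) N
      · exact Or.inl (Metric.mem_closedBall_self (by positivity))
      · rcases lt_or_ge n N with h | h
        · exact Or.inr ⟨n, h, hn⟩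
        · refine Or.inl (Metric.closedBall_subset_closedBall ?_
            (Metric.ball_subset_closedBall (hb n hn)))
          gcongr
    · intro h
      by_cases hz : z = x
      · exact Or.inl hz
      · obtain ⟨N, hN⟩ := exists_nat_one_div_lt (dist_pos.2 hz)
        rcases h N with h | ⟨n, -, hn⟩
        · exact absurd (Metric.mem_closedBall.1 h) (not_le.2 hN)
        · exact Or.inr ⟨n, hn⟩
  rw [this]
  exact isClosed_iInter fun N => Metric.isClosed_closedBall.union
    (isClosed_biUnion_finset fun n _ => hB n)

/-- Inside a clopen neighbourhood of a point of `C₁ X` there is a decreasing sequence of clopen sets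
shrinking to the point. -/
theorem exists_seq_isClopen_iInter {X : Type u} [MetricSpace X] [CompactSpace X] {y : X}
    (hy : y ∈ C₁ X) {V : Set X} (hV : IsClopen V) (hyV : y ∈ V) :
    ∃ S : ℕ → Set X, S 0 = V ∧ (∀ n, IsClopen (S n)) ∧ (∀ n, S (n + 1) ⊆ S n) ∧
      ⋂ n, S n = {y} := by
  choose W hW hyW hWb using fun n : ℕ => exists_isClopen_of_mem_C₁ hy
    (Metric.ball_mem_nhds y (by positivity : 0 < 1 / ((n : ℝ) + 1)))
  refine ⟨fun n => V ∩ ⋂ k ∈ Finset.range n, W k, by simp,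
    fun n => hV.inter (isClopen_biInter_finset fun k _ => hW k), fun n => ?_, ?_⟩
  · refine inter_subset_inter_right V (biInter_subset_biInter_left fun k hk => ?_)
    exact Finset.mem_coe.2 (Finset.mem_range.2 ((Finset.mem_range.1 hk).trans n.lt_succ_self))
  · refine Subset.antisymm (fun z hz => ?_) ?_
    · by_contra hzy
      obtain ⟨N, hN⟩ := exists_nat_one_div_lt (dist_pos.2 hzy)
      have := mem_iInter₂.1 (mem_iInter.1 hz (N + 1)).2 N (Finset.self_mem_range_succ N)
      exact lt_asymm hN (Metric.mem_ball.1 (hWb N this))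
    · exact singleton_subset_iff.2 (mem_iInter.2 fun n => ⟨hyV, mem_iInter₂.2 fun k _ => hyW k⟩)

/-- Deleting a further point of `C₁ X` from `X ∖ {x}` does not change the homeomorphism type. -/
theorem nonempty_homeomorph_compl_pair {X : Type u} [TopologicalSpace X]
    [TopologicalSpace.MetrizableSpace X] [CompactSpace X] (hh : HHomogeneous X)
    (hd : Dense (C₁ X)) {x y : X} (hy : y ∈ C₁ X) (hxy : x ≠ y) :
    Nonempty (({x}ᶜ : Set X) ≃ₜ ({x}ᶜ \ {y} : Set X)) := by
  let := TopologicalSpace.metrizableSpaceMetric X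
  have : Nontrivial X := ⟨x, y, hxy⟩
  obtain ⟨V, hV, hyV, hVx⟩ := exists_isClopen_of_mem_C₁ hy
    (isOpen_compl_singleton.mem_nhds hxy.symm : ({x}ᶜ : Set X) ∈ 𝓝 y)
  have hxV : x ∉ V := fun h => hVx h rfl
  obtain ⟨B, hB, hBn, hxB, hBV, hBb, hBd⟩ := exists_seq_isClopen hh hd x
    (hV.compl.isOpen.mem_nhds hxV)
  obtain ⟨S, hS0, hS, hSS, hSi⟩ := exists_seq_isClopen_iInter hy hV hyV
  have hSV : ∀ n, S n ⊆ V := fun n => hS0 ▸ antitone_nat_of_succ_le hSS (Nat.zero_le n)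
  let R : Set X := (V ∪ insert x (⋃ n, B n))ᶜ
  have hR : IsOpen R := (hV.isClosed.union
    (isClosed_insert_iUnion (fun n => (hB n).isClosed) hBb)).isOpen_compl
  -- `V` is put whole into piece `0` on one side, while on the other `V \ {y}` is spread as shells
  -- `Q n` over all pieces. The sets `B n` keep every piece a non-empty clopen set, so h-homogeneity
  -- matches them; they accumulate only at the deleted point `x`.
  let P : ℕ → Set X := fun n => if n = 0 then V else ∅
  have hP : ∀ n, IsClopen (P n) := fun n => by
    dsimp only [P]; split_ifs
    exacts [hV, isClopen_empty]
  have hPV : ∀ n, P n ⊆ V := fun n => by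
    dsimp only [P]; split_ifs
    exacts [Subset.rfl, empty_subset _]
  have hPd : Pairwise (Disjoint on P) := (pairwise_disjoint_on _).2 fun m n hmn => by
    have : P n = ∅ := if_neg (Nat.ne_zero_of_lt hmn)
    rw [this]
    exact disjoint_bot_right
  have hPu : ⋃ n, P n = V := Subset.antisymm (iUnion_subset hPV) (subset_iUnion P 0)
  let Q : ℕ → Set X := fun n => S n \ S (n + 1)
  have hQ : ∀ n, IsClopen (Q n) := fun n => (hS n).diff (hS (n + 1))
  have hQV : ∀ n, Q n ⊆ V := fun n => sdiff_subset.trans (hSV n)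
  have hQd : Pairwise (Disjoint on Q) := pairwise_disjoint_diff_succ hSS
  have hQu : ⋃ n, Q n = V \ {y} := by rw [iUnion_diff_succ hSS, hS0, hSi]
  have hopen : ∀ {P : ℕ → Set X}, (∀ n, IsClopen (P n)) →
      ∀ o : Option ℕ, IsOpen (o.elim R fun n => P n ∪ B n) := by
    rintro P hP (_ | n)
    exacts [hR, (hP n).isOpen.union (hB n).isOpen]
  have hdisj : ∀ {P : ℕ → Set X}, (∀ n, P n ⊆ V) → Pairwise (Disjoint on P) →
      Pairwise (Disjoint on fun o : Option ℕ => o.elim R fun n => P n ∪ B n) := by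
    intro P hPV hPd
    have hRn : ∀ n, Disjoint R (P n ∪ B n) := fun n => by
      refine disjoint_left.2 fun z hz hz' => hz ?_
      rcases hz' with h | h
      · exact Or.inl (hPV n h)
      · exact Or.inr (Or.inr (mem_iUnion.2 ⟨n, h⟩))
    rintro (_ | m) (_ | n) hmn
    · exact absurd rfl hmn
    · exact hRn n
    · exact (hRn m).symm
    · have hmn' : m ≠ n := fun h => hmn (h ▸ rfl)
      have hVB : ∀ i j, Disjoint (P i) (B j) := fun i j =>
        disjoint_left.2 fun z h h' => hBV j h' (hPV i h)
      exact ((hPd hmn').union_right (hVB m n)).union_left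
        ((hVB n m).symm.union_right (hBd hmn'))
  have hunion : ∀ {P : ℕ → Set X}, ⋃ o : Option ℕ, (o.elim R fun n => P n ∪ B n) =
      R ∪ (⋃ n, P n) ∪ ⋃ n, B n := by
    intro P
    rw [iUnion_option, union_assoc, ← iUnion_union_distrib]
    rfl
  have key := nonempty_homeomorph_iUnion (hopen hP) (hopen hQ) (hdisj hPV hPd) (hdisj hQV hQd) (by
    rintro (_ | n)
    · exact ⟨Homeomorph.refl _⟩
    · exact hh.nonempty_homeomorph ((hP n).union (hB n)) ((hQ n).union (hB n))
        ((hBn n).mono subset_union_right) ((hBn n).mono subset_union_right))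
  rw [hunion, hunion, hPu, hQu] at key
  have hxU : x ∉ ⋃ n, B n := by simpa using hxB
  have hyU : y ∉ ⋃ n, B n := by
    simp only [mem_iUnion, not_exists]
    exact fun n h => hBV n h hyV
  have e₁ : R ∪ V ∪ ⋃ n, B n = {x}ᶜ := by
    ext z
    simp only [R, mem_union, mem_compl_iff, mem_insert_iff, mem_singleton_iff]
    constructor
    · rintro h rfl
      tauto
    · tauto
  have e₂ : R ∪ (V \ {y}) ∪ ⋃ n, B n = {x}ᶜ \ {y} := by
    ext z
    simp only [R, mem_union, mem_compl_iff, mem_insert_iff, mem_singleton_iff, Set.mem_sdiff]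
    constructor
    · intro h
      constructor
      · rintro rfl
        tauto
      · rintro rfl
        tauto
    · tauto
  rwa [e₁, e₂] at key

/-- A compact metrizable h-homogeneous space with a dense set of singleton components is not
reconstructible: deleting one of these components gives a non-homeomorphic reconstruction. -/
theorem not_reconstructible {X : Type u} [TopologicalSpace X]
    [TopologicalSpace.MetrizableSpace X] [CompactSpace X] [Nontrivial X] (hh : HHomogeneous X)
    (hd : Dense (C₁ X)) : ¬ Reconstructible X := by
  intro hrec
  obtain ⟨y, hy⟩ := hd.nonempty
  obtain ⟨y', hy', hyC⟩ := hd.inter_open_nonempty {y}ᶜ isOpen_compl_singleton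
    (exists_ne y)
  have hne : y ≠ y' := Ne.symm hy'
  have hcard : ∀ t : ({y}ᶜ : Set X),
      Nonempty (({(t : X)}ᶜ : Set X) ≃ₜ ({t}ᶜ : Set ({y}ᶜ : Set X))) := fun t => by
    obtain ⟨e₁⟩ := nonempty_homeomorph_compl_pair hh hd hy t.2
    obtain ⟨e₂⟩ := nonempty_homeomorph_diff_singleton t
    refine ⟨(e₁.trans (Homeomorph.setCongr ?_)).trans e₂.symm⟩
    rw [sdiff_eq, sdiff_eq, inter_comm]
  obtain ⟨e⟩ := hrec ({y}ᶜ : Set X) (by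
    intro Y _
    constructor
    · rintro ⟨t, ⟨f⟩⟩
      exact ⟨t, ⟨f.trans (hcard t).some.symm⟩⟩
    · rintro ⟨x, ⟨f⟩⟩
      -- The card of `X` at `y` itself is recovered by deleting a second point `y'` of `C₁ X`.
      by_cases hx : x = y
      · subst hx
        obtain ⟨e₁⟩ := nonempty_homeomorph_compl_pair hh hd hyC hne
        obtain ⟨e₂⟩ := nonempty_homeomorph_diff_singleton (⟨y', hy'⟩ : ({x}ᶜ : Set X))
        exact ⟨⟨y', hy'⟩, ⟨(f.trans e₁).trans e₂.symm⟩⟩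
      · exact ⟨⟨x, hx⟩, ⟨f.trans (hcard ⟨x, hx⟩).some⟩⟩)
  have : CompactSpace ({y}ᶜ : Set X) := e.symm.compactSpace
  have hcl : IsClosed ({y}ᶜ : Set X) := (isCompact_iff_compactSpace.2 this).isClosed
  exact hh.not_isOpen_singleton y (isClosed_compl_iff.1 hcl)

/-! ### Clopen pieces of a non-compact reconstruction -/

/-- A non-compact locally compact space `W` with a one-point deletion `X ∖ {x}`, where `X` is
compact and `{x}` is a component of `X`, contains a non-compact clopen set coming from a
given neighbourhood of `x`. -/
theorem exists_isClopen_not_isCompact {W X : Type u} [TopologicalSpace W] [TopologicalSpace X]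
    [T2Space W] [LocallyCompactSpace W] [T2Space X] [CompactSpace X]
    (hW : ¬ CompactSpace W) {w : W} {x : X} (hx : x ∈ C₁ X) {f : ({x}ᶜ : Set X) → W}
    (hf : IsOpenEmbedding f) (hfr : range f = {w}ᶜ) {U : Set X} (hU : U ∈ 𝓝 x) :
    ∃ D : Set W, IsClopen D ∧ ¬ IsCompact D ∧ D ⊆ f '' (Subtype.val ⁻¹' U) := by
  obtain ⟨N, hN, hwN⟩ := exists_compact_mem_nhds w
  have hwi : w ∈ interior N := mem_interior_iff_mem_nhds.2 hwN
  have hfN : IsCompact (f ⁻¹' frontier N) := by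
    refine hf.isInducing.isCompact_preimage' ?_ ?_
    · exact hN.of_isClosed_subset isClosed_frontier hN.isClosed.frontier_subset
    · rw [hfr]
      rintro z hz rfl
      exact hz.2 hwi
  have hK := hfN.image continuous_subtype_val
  -- The preimage of `frontier N` is compact and misses `x`, so `V` can avoid it. Then `f(V) \ N`
  -- has the open complement `f(Vᶜ) ∪ interior N`.
  obtain ⟨V, hV, hxV, hVU⟩ := exists_isClopen_of_mem_C₁ hx (inter_mem hU
    (hK.isClosed.isOpen_compl.mem_nhds (by rintro ⟨p, -, hp⟩; exact p.2 hp)))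
  have hVo : IsOpen (f '' (Subtype.val ⁻¹' V)) :=
    hf.isOpenMap _ (hV.isOpen.preimage continuous_subtype_val)
  have hVo' : IsOpen (f '' (Subtype.val ⁻¹' Vᶜ)) :=
    hf.isOpenMap _ (hV.compl.isOpen.preimage continuous_subtype_val)
  have hcov : ∀ z, z ≠ w → z ∈ f '' (Subtype.val ⁻¹' V) ∨ z ∈ f '' (Subtype.val ⁻¹' Vᶜ) := by
    intro z hz
    obtain ⟨p, rfl⟩ : z ∈ range f := hfr ▸ hz
    by_cases hp : (p : X) ∈ V
    · exact Or.inl ⟨p, hp, rfl⟩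
    · exact Or.inr ⟨p, hp, rfl⟩
  have hdis : ∀ z, z ∈ f '' (Subtype.val ⁻¹' V) → z ∉ f '' (Subtype.val ⁻¹' Vᶜ) := by
    rintro _ ⟨p, hp, rfl⟩ ⟨q, hq, hqp⟩
    rw [hf.injective hqp] at hq
    exact hq hp
  have hfw : ∀ z A, z ∈ f '' A → z ≠ w := by
    rintro _ A ⟨p, -, rfl⟩
    have : f p ∈ range f := mem_range_self p
    rw [hfr] at this
    exact this
  have hD : f '' (Subtype.val ⁻¹' V) \ N = (f '' (Subtype.val ⁻¹' Vᶜ) ∪ interior N)ᶜ := by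
    ext z
    constructor
    · rintro ⟨h₁, h₂⟩ (h₃ | h₃)
      · exact hdis z h₁ h₃
      · exact h₂ (interior_subset h₃)
    · intro h
      have h₁ : z ∉ interior N := fun h' => h (Or.inr h')
      have hz : z ∈ f '' (Subtype.val ⁻¹' V) :=
        (hcov z (fun hzw => h₁ (hzw ▸ hwi))).resolve_right fun h' => h (Or.inl h')
      refine ⟨hz, fun hzN => ?_⟩
      obtain ⟨p, hp, rfl⟩ := hz
      exact (hVU hp).2 ⟨p, ⟨subset_closure hzN, h₁⟩, rfl⟩
  refine ⟨f '' (Subtype.val ⁻¹' V) \ N, ⟨?_, hVo.sdiff hN.isClosed⟩, fun hc => hW ?_, ?_⟩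
  · rw [hD]
    exact (hVo'.union isOpen_interior).isClosed_compl
  · have hc' : IsCompact (f '' (Subtype.val ⁻¹' Vᶜ)) := by
      refine IsCompact.image ?_ hf.continuous
      refine IsEmbedding.subtypeVal.isInducing.isCompact_preimage'
        hV.compl.isClosed.isCompact ?_
      rw [Subtype.range_coe]
      rintro z hz rfl
      exact hz hxV
    -- If `f(V) \ N` were compact, then with `N` and `f(Vᶜ)` it would cover `W` by compact sets.
    refine isCompact_univ_iff.1 (((hc.union hN).union hc').of_isClosed_subset isClosed_univ ?_)
    intro z _
    by_cases hzN : z ∈ N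
    · exact Or.inl (Or.inr hzN)
    · rcases hcov z (fun hzw => hzN (hzw ▸ interior_subset hwi)) with h | h
      · exact Or.inl (Or.inl ⟨h, hzN⟩)
      · exact Or.inr h
  · rintro z ⟨⟨p, hp, rfl⟩, -⟩
    exact ⟨p, (hVU hp).1, rfl⟩

/-- A compact open subset of `W` lying in the copy of `Y` pulls back to a non-empty clopen subset of
`Y`, to which h-homogeneity applies. -/
theorem HHomogeneous.nonempty_homeomorph_of_subset_image {W X Y : Type u} [TopologicalSpace W]
    [TopologicalSpace X] [TopologicalSpace Y] [T1Space X] [T2Space Y]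
    (hh : HHomogeneous Y) {i : Y → X}
    (hi : IsOpenEmbedding i) {x : X} {f : ({x}ᶜ : Set X) → W} (hf : IsOpenEmbedding f)
    {Q : Set W} (hQo : IsOpen Q) (hQc : IsCompact Q) (hQn : Q.Nonempty)
    (hQ : Q ⊆ f '' (Subtype.val ⁻¹' range i)) : Nonempty (Q ≃ₜ Y) := by
  let P : Set Y := i ⁻¹' (Subtype.val '' (f ⁻¹' Q))
  have h₁ : f '' (f ⁻¹' Q) = Q :=
    image_preimage_eq_of_subset (hQ.trans (image_subset_range _ _))
  have h₂ : i '' P = Subtype.val '' (f ⁻¹' Q) := by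
    refine image_preimage_eq_of_subset ?_
    rintro _ ⟨p, hp, rfl⟩
    obtain ⟨q, hq, hqp⟩ := hQ hp
    exact hf.injective hqp ▸ hq
  have e : P ≃ₜ Q := (hi.isEmbedding.homeomorphImage P).trans <|
    (Homeomorph.setCongr h₂).trans <|
    (IsEmbedding.subtypeVal.homeomorphImage (f ⁻¹' Q)).symm.trans <|
    (hf.isEmbedding.homeomorphImage (f ⁻¹' Q)).trans (Homeomorph.setCongr h₁)
  have hPo : IsOpen P := (isOpen_compl_singleton.isOpenMap_subtype_val _
    (hQo.preimage hf.continuous)).preimage hi.continuous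
  have : CompactSpace Q := isCompact_iff_compactSpace.1 hQc
  have hPc : IsCompact P := isCompact_iff_compactSpace.2 e.symm.compactSpace
  obtain ⟨q, hq⟩ := hQn
  exact ⟨e.symm.trans (hh P ⟨hPc.isClosed, hPo⟩ ⟨_, (e.symm ⟨q, hq⟩).2⟩).some⟩

/-! ### Singleton components of sums and subspaces -/

theorem mem_C₁_iff {X : Type u} [TopologicalSpace X] {x : X} :
    x ∈ C₁ X ↔ connectedComponent x = {x} := Iff.rfl

theorem inl_mem_C₁ {Y Z : Type u} [TopologicalSpace Y] [TopologicalSpace Z] [CompactSpace Y]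
    [CompactSpace Z] [T2Space Y] [T2Space Z] {y : Y} (hy : y ∈ C₁ Y) :
    (Sum.inl y : Y ⊕ Z) ∈ C₁ (Y ⊕ Z) := by
  refine mem_C₁_of_forall fun U hU => ?_
  obtain ⟨V, hV, hyV, hVU⟩ := exists_isClopen_of_mem_C₁ hy (continuous_inl.continuousAt hU)
  exact ⟨Sum.inl '' V, ⟨isClosedMap_inl _ hV.isClosed, isOpenMap_inl _ hV.isOpen⟩,
    mem_image_of_mem _ hyV, image_subset_iff.2 hVU⟩

theorem inr_mem_C₁ {Y Z : Type u} [TopologicalSpace Y] [TopologicalSpace Z] [CompactSpace Y]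
    [CompactSpace Z] [T2Space Y] [T2Space Z] {z : Z} (hz : z ∈ C₁ Z) :
    (Sum.inr z : Y ⊕ Z) ∈ C₁ (Y ⊕ Z) := by
  refine mem_C₁_of_forall fun U hU => ?_
  obtain ⟨V, hV, hzV, hVU⟩ := exists_isClopen_of_mem_C₁ hz (continuous_inr.continuousAt hU)
  exact ⟨Sum.inr '' V, ⟨isClosedMap_inr _ hV.isClosed, isOpenMap_inr _ hV.isOpen⟩,
    mem_image_of_mem _ hzV, image_subset_iff.2 hVU⟩

theorem not_mem_C₁_map {X Y : Type u} [TopologicalSpace X] [TopologicalSpace Y] {f : X → Y}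
    (hf : Continuous f) (hi : Injective f) {x : X} (hx : x ∉ C₁ X) : f x ∉ C₁ Y := by
  refine fun h => hx (Subset.antisymm (fun y hy => ?_)
    (singleton_subset_iff.2 mem_connectedComponent))
  have := hf.image_connectedComponent_subset x (mem_image_of_mem f hy)
  rw [mem_C₁_iff.1 h] at this
  exact hi this

theorem dense_sum {Y Z : Type u} [TopologicalSpace Y] [TopologicalSpace Z] {A : Set Y} {B : Set Z}
    {S : Set (Y ⊕ Z)} (hA : Dense A) (hB : Dense B) (hAS : ∀ y ∈ A, Sum.inl y ∈ S)
    (hBS : ∀ z ∈ B, Sum.inr z ∈ S) : Dense S := by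
  rintro (y | z)
  · exact map_mem_closure continuous_inl (hA y) hAS
  · exact map_mem_closure continuous_inr (hB z) hBS

/-! ### Topological properties inherited from the deck -/

section Deck

variable {W X : Type u} [TopologicalSpace W] [TopologicalSpace X]

theorem IsReconstruction.exists_homeomorph (h : IsReconstruction W X) (x : X) :
    ∃ w : W, Nonempty (({x}ᶜ : Set X) ≃ₜ ({w}ᶜ : Set W)) :=
  (h ({x}ᶜ : Set X)).2 ⟨x, ⟨Homeomorph.refl _⟩⟩

theorem IsReconstruction.symm (h : IsReconstruction W X) : IsReconstruction X W :=
  fun Y _ => (h Y).symm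

theorem IsReconstruction.infinite [Infinite X] [Nonempty X] (h : IsReconstruction W X) :
    Infinite W := by
  obtain ⟨w, ⟨e⟩⟩ := h.exists_homeomorph (Classical.arbitrary X)
  have : Infinite ({Classical.arbitrary X}ᶜ : Set X) := (finite_singleton _).infinite_compl.to_subtype
  have : Infinite ({w}ᶜ : Set W) := e.toEquiv.infinite_iff.1 this
  exact Infinite.of_injective _ (Subtype.val_injective (p := (· ∈ ({w}ᶜ : Set W))))

/-- For each `x ≠ a`, the T1 card at `x` makes `{a}ᶜ` open either with or without `x`. In the second
case for two different `x`, the union of the two open sets is `{a}ᶜ`. -/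
theorem IsReconstruction.t1Space [Infinite X] [T1Space X] (h : IsReconstruction W X) :
    T1Space W := by
  have := h.infinite
  refine ⟨fun a => ?_⟩
  have key : ∀ x, x ≠ a → IsOpen ({a}ᶜ : Set W) ∨ IsOpen ({a}ᶜ \ {x} : Set W) := by
    intro x hx
    obtain ⟨y, ⟨e⟩⟩ := h.symm.exists_homeomorph x
    have : T1Space ({x}ᶜ : Set W) := e.symm.t1Space
    obtain ⟨O, hO, hOe⟩ := isOpen_induced_iff.1
      (isOpen_compl_singleton : IsOpen ({⟨a, hx.symm⟩}ᶜ : Set ({x}ᶜ : Set W)))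
    have hmem : ∀ z, z ≠ x → (z ∈ O ↔ z ≠ a) := fun z hz => by
      have := Set.ext_iff.1 hOe ⟨z, hz⟩
      simpa [Subtype.ext_iff] using this
    have haO : a ∉ O := fun h' => (hmem a hx.symm).1 h' rfl
    by_cases hxO : x ∈ O
    · left
      convert hO using 1
      ext z
      by_cases hz : z = x
      · subst hz; simp [hxO, hx]
      · exact (hmem z hz).symm
    · right
      convert hO using 1
      ext z
      by_cases hz : z = x
      · subst hz; simp [hxO]
      · simp [hz, hmem z hz]
  obtain ⟨x, hx⟩ := Infinite.exists_notMem_finset ({a} : Finset W)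
  classical
  obtain ⟨x', hx'⟩ := Infinite.exists_notMem_finset ({a, x} : Finset W)
  simp only [Finset.mem_singleton, Finset.mem_insert, not_or] at hx hx'
  rw [← isOpen_compl_iff]
  rcases key x hx with h₁ | h₁
  · exact h₁
  rcases key x' hx'.1 with h₂ | h₂
  · exact h₂
  convert h₁.union h₂ using 1
  ext z
  simp only [mem_compl_iff, mem_singleton_iff, mem_union, Set.mem_sdiff]
  by_cases hz : z = x
  · subst hz
    have := hx'.2
    tauto
  · tauto

theorem IsReconstruction.t2Space [Infinite X] [T2Space X] (h : IsReconstruction W X) :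
    T2Space W := by
  have := h.infinite
  have := h.t1Space
  refine ⟨fun a b hab => ?_⟩
  classical
  obtain ⟨x, hx⟩ := Infinite.exists_notMem_finset ({a, b} : Finset W)
  simp only [Finset.mem_singleton, Finset.mem_insert, not_or] at hx
  obtain ⟨y, ⟨e⟩⟩ := h.symm.exists_homeomorph x
  have : T2Space ({x}ᶜ : Set W) := e.symm.t2Space
  obtain ⟨u, v, hu, hv, hau, hbv, huv⟩ := t2_separation
    (show (⟨a, Ne.symm hx.1⟩ : ({x}ᶜ : Set W)) ≠ ⟨b, Ne.symm hx.2⟩ from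
      fun h => hab (congrArg Subtype.val h))
  have hm := (isOpen_compl_singleton : IsOpen ({x}ᶜ : Set W)).isOpenMap_subtype_val
  exact ⟨_, _, hm u hu, hm v hv, ⟨_, hau, rfl⟩, ⟨_, hbv, rfl⟩,
    (disjoint_image_iff Subtype.val_injective).2 huv⟩

theorem IsReconstruction.locallyCompactSpace [Infinite X] [T2Space X] [LocallyCompactSpace X]
    (h : IsReconstruction W X) : LocallyCompactSpace W := by
  have := h.infinite
  have := h.t2Space
  have : WeaklyLocallyCompactSpace W := by
    refine ⟨fun a => ?_⟩
    obtain ⟨x, hx⟩ := Infinite.exists_notMem_finset ({a} : Finset W)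
    rw [Finset.mem_singleton] at hx
    obtain ⟨y, ⟨e⟩⟩ := h.symm.exists_homeomorph x
    have : LocallyCompactSpace ({y}ᶜ : Set X) :=
      (isOpen_compl_singleton : IsOpen ({y}ᶜ : Set X)).locallyCompactSpace
    have : LocallyCompactSpace ({x}ᶜ : Set W) := e.isClosedEmbedding.locallyCompactSpace
    obtain ⟨K, hK, haK⟩ := exists_compact_mem_nhds (⟨a, Ne.symm hx⟩ : ({x}ᶜ : Set W))
    have ho : IsOpen ({x}ᶜ : Set W) := isOpen_compl_singleton
    exact ⟨_, hK.image continuous_subtype_val,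
      ho.isOpenEmbedding_subtypeVal.isOpenMap.image_mem_nhds haK⟩
  infer_instance

end Deck

/-! ### Reconstructing the sum -/

/-- The topological sum of two non-homeomorphic infinite compact Hausdorff h-homogeneous spaces
with singleton components is reconstructible. -/
theorem reconstructible_sum {Y Z : Type u} [TopologicalSpace Y] [TopologicalSpace Z]
    [CompactSpace Y] [CompactSpace Z] [T2Space Y] [T2Space Z] [Infinite Y]
    (hY : HHomogeneous Y) (hZ : HHomogeneous Z) {y : Y} (hy : y ∈ C₁ Y) {z : Z} (hz : z ∈ C₁ Z)
    (hYZ : ¬ Nonempty (Y ≃ₜ Z)) : Reconstructible (Y ⊕ Z) := by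
  intro W _ hW
  have := hW.t2Space
  have := hW.locallyCompactSpace
  obtain ⟨w, ⟨e⟩⟩ := hW.exists_homeomorph (Sum.inl y)
  obtain ⟨w', ⟨e'⟩⟩ := hW.exists_homeomorph (Sum.inr z)
  by_cases hc : CompactSpace W
  · exact nonempty_homeomorph_of_compl ⟨e.symm⟩
  have ho : ∀ v : W, IsOpenEmbedding (Subtype.val : ({v}ᶜ : Set W) → W) :=
    fun v => isOpen_compl_singleton.isOpenEmbedding_subtypeVal
  let f : ({Sum.inl y}ᶜ : Set (Y ⊕ Z)) → W := Subtype.val ∘ e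
  let g : ({Sum.inr z}ᶜ : Set (Y ⊕ Z)) → W := Subtype.val ∘ e'
  have hf : IsOpenEmbedding f := (ho w).comp e.isOpenEmbedding
  have hg : IsOpenEmbedding g := (ho w').comp e'.isOpenEmbedding
  have hfr : range f = {w}ᶜ := by
    rw [range_comp, e.surjective.range_eq, image_univ, Subtype.range_coe]
  have hgr : range g = {w'}ᶜ := by
    rw [range_comp, e'.surjective.range_eq, image_univ, Subtype.range_coe]
  obtain ⟨D, hD, hDc, hDf⟩ := exists_isClopen_not_isCompact hc (inl_mem_C₁ hy) hf hfr
    (isOpen_range_inl.mem_nhds (mem_range_self y))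
  have hcompact : ∀ A : Set (Y ⊕ Z), IsClosed A → Sum.inr z ∉ A →
      IsCompact (g '' (Subtype.val ⁻¹' A)) := by
    intro A hA hzA
    refine (IsEmbedding.subtypeVal.isInducing.isCompact_preimage' hA.isCompact ?_).image
      hg.continuous
    rw [Subtype.range_coe]
    rintro p hp rfl
    exact hzA hp
  -- Otherwise the closed set `D` lies in the compact union of `{w'}` and the `g`-image of `Y`.
  obtain ⟨q, hqD, hqw, hqg⟩ : ∃ q ∈ D, q ≠ w' ∧ q ∉ g '' (Subtype.val ⁻¹' range Sum.inl) := by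
    by_contra! hcon
    refine hDc (((isCompact_singleton (x := w')).union
      (hcompact (range Sum.inl) isClosed_range_inl (by simp))).of_isClosed_subset hD.isClosed ?_)
    intro q hq
    by_cases hqw : q = w'
    · exact Or.inl hqw
    · exact Or.inr (hcon q hq hqw)
  obtain ⟨⟨p | c, hp⟩, rfl⟩ : q ∈ range g := hgr ▸ hqw
  · exact absurd ⟨_, ⟨p, rfl⟩, rfl⟩ hqg
  have hcz : c ≠ z := fun h => hp (h ▸ rfl)
  obtain ⟨V, hV, hzV, hVc⟩ := exists_isClopen_of_mem_C₁ hz (isOpen_compl_singleton.mem_nhds hcz.symm)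
  -- Cutting off the neighbourhood `V` of the deleted point `z` makes this part of `D` compact; it
  -- still contains `q`, the image of `c`.
  have hQo : IsOpen (g '' (Subtype.val ⁻¹' (Sum.inr '' Vᶜ)) ∩ D) :=
    (hg.isOpenMap _ ((isOpenMap_inr _ hV.compl.isOpen).preimage continuous_subtype_val)).inter
      hD.isOpen
  have hQc : IsCompact (g '' (Subtype.val ⁻¹' (Sum.inr '' Vᶜ)) ∩ D) := by
    refine (hcompact _ (isClosedMap_inr _ hV.compl.isClosed) ?_).inter_right hD.isClosed
    rintro ⟨z', hz', h⟩
    exact hz' (Sum.inr_injective h ▸ hzV)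
  have hQn : (g '' (Subtype.val ⁻¹' (Sum.inr '' Vᶜ)) ∩ D).Nonempty :=
    ⟨_, ⟨_, ⟨c, fun h => hVc h rfl, rfl⟩, rfl⟩, hqD⟩
  obtain ⟨a⟩ := hY.nonempty_homeomorph_of_subset_image IsOpenEmbedding.inl hf hQo hQc hQn
    (inter_subset_right.trans hDf)
  obtain ⟨b⟩ := hZ.nonempty_homeomorph_of_subset_image IsOpenEmbedding.inr hg hQo hQc hQn
    (inter_subset_left.trans (image_mono (preimage_mono (image_subset_range _ _))))
  exact absurd ⟨a.symm.trans b⟩ hYZ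

/-! ### Countable powers -/

theorem singleton_mem_C₁_pi {ι : Type*} {L : Type u} [TopologicalSpace L] [T1Space L] {x : ι → L}
    (hx : ∀ i, IsOpen ({x i} : Set L)) : connectedComponent x = {x} := by
  refine Subset.antisymm (fun y hy => ?_) (singleton_subset_iff.2 mem_connectedComponent)
  funext i
  have h := (continuous_apply i).image_connectedComponent_subset x (mem_image_of_mem _ hy)
  exact IsClopen.connectedComponent_subset (s := {x i}) ⟨isClosed_singleton, hx i⟩ rfl h

/-- Every neighbourhood in a sequence space contains a cylinder. -/
theorem exists_cylinder_subset {L : Type u} [TopologicalSpace L] {U : Set (ℕ → L)} (hU : IsOpen U)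
    {x : ℕ → L} (hx : x ∈ U) : ∃ N : ℕ, ∀ y : ℕ → L, (∀ i < N, y i = x i) → y ∈ U := by
  obtain ⟨I, u, hu, hIU⟩ := isOpen_pi_iff.1 hU x hx
  refine ⟨I.sup id + 1, fun y hy => hIU fun i hi => ?_⟩
  rw [hy i (Nat.lt_succ_of_le (Finset.le_sup (f := id) hi))]
  exact (hu i hi).2

theorem exists_isolated_mem {L : Type u} [TopologicalSpace L]
    (hL : Dense {p : L | IsOpen ({p} : Set L)}) {U : Set (ℕ → L)} (hU : IsOpen U)
    (hne : U.Nonempty) : ∃ x ∈ U, ∀ i, IsOpen ({x i} : Set L) := by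
  obtain ⟨x, hxU, hx⟩ := (dense_pi univ fun (_ : ℕ) _ => hL).inter_open_nonempty U hU hne
  exact ⟨x, hxU, fun i => hx i (mem_univ i)⟩

/-- Replacing the first `N` coordinates by isolated points embeds a sequence space onto a
cylinder. -/
theorem isOpenEmbedding_prepend {L : Type u} [TopologicalSpace L] {x : ℕ → L}
    (hx : ∀ i, IsOpen ({x i} : Set L)) (N : ℕ) :
    IsOpenEmbedding fun (z : ℕ → L) (i : ℕ) => if i < N then x i else z (i - N) := by
  have hc : Continuous fun (z : ℕ → L) (i : ℕ) => if i < N then x i else z (i - N) := by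
    refine continuous_pi fun i => ?_
    by_cases h : i < N
    · simpa [h] using continuous_const
    · simpa [h] using continuous_apply (i - N)
  refine ⟨IsEmbedding.of_leftInverse (f := fun (y : ℕ → L) i => y (i + N)) ?_
    (continuous_pi fun i => continuous_apply _) hc, ?_⟩
  · intro z
    funext i
    simp
  · have : range (fun (z : ℕ → L) (i : ℕ) => if i < N then x i else z (i - N)) =
        (Finset.range N : Set ℕ).pi fun i => {x i} := by
      ext y
      constructor
      · rintro ⟨z, rfl⟩ i hi
        simp only [Finset.coe_range, mem_Iio] at hi
        simp [hi]
      · intro hy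
        refine ⟨fun i => y (i + N), funext fun i => ?_⟩
        by_cases h : i < N
        · have := hy i (by simpa using h)
          simpa [h] using this.symm
        · simp [h, Nat.sub_add_cancel (not_lt.1 h)]
    rw [this]
    exact isOpen_set_pi (Finset.finite_toSet _) fun i _ => hx i

theorem hHomogeneous_pi {L : Type u} [TopologicalSpace L] [CompactSpace L]
    [TopologicalSpace.MetrizableSpace L] (hL : Dense {p : L | IsOpen ({p} : Set L)}) :
    HHomogeneous (ℕ → L) := by
  refine hHomogeneous_of_forall_isOpen fun U hU hne => ?_
  obtain ⟨x, hxU, hx⟩ := exists_isolated_mem hL hU hne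
  obtain ⟨N, hN⟩ := exists_cylinder_subset hU hxU
  refine ⟨_, isOpenEmbedding_prepend hx N, ?_⟩
  rintro _ ⟨z, rfl⟩
  exact hN _ fun i hi => by simp [hi]

theorem dense_C₁_pi {L : Type u} [TopologicalSpace L] [T1Space L]
    (hL : Dense {p : L | IsOpen ({p} : Set L)}) : Dense (C₁ (ℕ → L)) := by
  refine dense_iff_inter_open.2 fun U hU hne => ?_
  obtain ⟨x, hxU, hx⟩ := exists_isolated_mem hL hU hne
  exact ⟨x, hxU, singleton_mem_C₁_pi hx⟩

theorem dense_compl_C₁_pi {L : Type u} [TopologicalSpace L] {p : L} (hp : p ∉ C₁ L) :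
    Dense (C₁ (ℕ → L))ᶜ := by
  refine dense_iff_inter_open.2 fun U hU ⟨x, hx⟩ => ?_
  obtain ⟨N, hN⟩ := exists_cylinder_subset hU hx
  -- Coordinate `N` is free in the cylinder, and varying it embeds `L` in the power.
  refine ⟨update x N p, hN _ fun i hi => update_of_ne hi.ne _ _, ?_⟩
  exact not_mem_C₁_map (continuous_const.update N continuous_id) (update_injective x N) hp

theorem not_nonempty_homeomorph_cantorSet {X : Type} [TopologicalSpace X] {x : X}
    (hx : x ∉ C₁ X) : ¬ Nonempty (X ≃ₜ ↥cantorSet) := by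
  rintro ⟨e⟩
  have e' := e.trans cantorSetHomeomorphNatToBool
  refine not_mem_C₁_map e'.continuous e'.injective hx ?_
  exact totallyDisconnectedSpace_iff_connectedComponent_singleton.1 inferInstance _

/-! ### Attaching a sequence of isolated points to a compact space -/

/-- The compactification of a countable discrete space with remainder `K`. The isolated points
`(n, d m)`, `m ≤ n`, accumulate at `(⊤, k)` for each `k` in the closure of the range of `d`. -/
def fringe {K : Type u} (d : ℕ → K) : Set (ℕ∞ × K) :=
  {p | ∀ n : ℕ, p.1 = n → p.2 ∈ d '' Iic n}

/-- The inclusion of the remainder. -/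
def remainder {K : Type u} (d : ℕ → K) (k : K) : fringe d :=
  ⟨(⊤, k), fun n hn => absurd hn.symm (ENat.natCast_ne_top n)⟩

theorem remainder_injective {K : Type u} (d : ℕ → K) : Injective (remainder d) :=
  fun _ _ h => congrArg (fun p => p.1.2) h

section Fringe

variable {K : Type u} [TopologicalSpace K] {d : ℕ → K}

theorem isClosed_fringe [T1Space K] (d : ℕ → K) : IsClosed (fringe d) := by
  have : fringe d = ⋂ n : ℕ, (Prod.fst ⁻¹' {(n : ℕ∞)}ᶜ ∪ Prod.snd ⁻¹' (d '' Iic n)) := by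
    ext p
    simp [fringe, imp_iff_not_or]
  rw [this]
  refine isClosed_iInter fun n => IsClosed.union ?_ ?_
  · exact (ENat.isOpen_singleton (ENat.natCast_ne_top n)).isClosed_compl.preimage continuous_fst
  · exact ((finite_Iic n).image d).isClosed.preimage continuous_snd

instance [T1Space K] [CompactSpace K] : CompactSpace (fringe d) :=
  isCompact_iff_compactSpace.1 (isClosed_fringe d).isCompact

instance : TopologicalSpace.MetrizableSpace ℕ∞ :=
  TopologicalSpace.metrizableSpace_of_t3_secondCountable _

theorem isOpen_singleton_of_fst_ne_top [T1Space K] (p : fringe d) (hp : p.1.1 ≠ ⊤) :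
    IsOpen ({p} : Set (fringe d)) := by
  obtain ⟨n, hn⟩ := ENat.ne_top_iff_exists.1 hp
  have : ({p} : Set (fringe d)) =
      Subtype.val ⁻¹' ({(n : ℕ∞)} ×ˢ (d '' Iic n \ {p.1.2})ᶜ) := by
    ext q
    simp only [mem_singleton_iff, mem_preimage, mem_prod, mem_compl_iff, Set.mem_sdiff, not_and,
      not_not]
    constructor
    · rintro rfl
      exact ⟨hn.symm, fun _ => rfl⟩
    · rintro ⟨h₁, h₂⟩
      exact Subtype.ext (Prod.ext (h₁.trans hn) (h₂ (q.2 n h₁)))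
  rw [this]
  refine IsOpen.preimage continuous_subtype_val
    ((ENat.isOpen_singleton (ENat.natCast_ne_top n)).prod ?_)
  exact (((finite_Iic n).image d).subset sdiff_subset).isClosed.isOpen_compl

theorem dense_isolated_fringe [T1Space K] (hd : DenseRange d) :
    Dense {p : fringe d | IsOpen ({p} : Set (fringe d))} := by
  intro p
  by_cases hp : p.1.1 = ⊤
  · rw [mem_closure_iff_nhds]
    intro U hU
    obtain ⟨U', hU', hUU'⟩ := mem_nhds_subtype _ _ _ |>.1 hU
    obtain ⟨A, hA, B, hB, hAB⟩ := mem_nhds_prod_iff.1 hU'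
    -- The isolated point is `(n, d m)`: first `d m` close to the given point of `K`, then `n ≥ m`
    -- close to `⊤`.
    obtain ⟨m, hm⟩ := hd.exists_mem_open isOpen_interior ⟨_, mem_interior_iff_mem_nhds.2 hB⟩
    rw [hp] at hA
    obtain ⟨n, hn, hmn⟩ := ((ENat.tendsto_natCast_nhds_top.eventually hA).and
      (eventually_ge_atTop m)).exists
    refine ⟨⟨((n : ℕ∞), d m), fun k hk => ⟨m, ?_, rfl⟩⟩, hUU' (hAB ⟨hn, interior_subset hm⟩),
      isOpen_singleton_of_fst_ne_top _ (ENat.natCast_ne_top n)⟩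
    rw [← Nat.cast_inj.1 hk]
    exact hmn
  · exact subset_closure (isOpen_singleton_of_fst_ne_top p hp)

theorem continuous_remainder (d : ℕ → K) : Continuous (remainder d) :=
  (continuous_const.prodMk continuous_id).subtype_mk _

/-- A component with an isolated point is a singleton; any two other points lie in the remainder, a
continuous image of the path-connected `K`. -/
theorem joined_fringe [T1Space K] [PathConnectedSpace K] {p q : fringe d}
    (h : q ∈ connectedComponent p) : Joined p q := by
  have key : ∀ {p q : fringe d}, q ∈ connectedComponent p → p.1.1 ≠ ⊤ → q = p := fun {p q} h hp =>
    IsClopen.connectedComponent_subset (s := {p})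
      ⟨isClosed_singleton, isOpen_singleton_of_fst_ne_top p hp⟩ rfl h
  by_cases hp : p.1.1 = ⊤
  · by_cases hq : q.1.1 = ⊤
    · have hp' : p = remainder d p.1.2 := Subtype.ext (Prod.ext hp rfl)
      have hq' : q = remainder d q.1.2 := Subtype.ext (Prod.ext hq rfl)
      rw [hp', hq']
      exact (PathConnectedSpace.joined p.1.2 q.1.2).map (continuous_remainder d)
    · have hpq : p = q := key (connectedComponent_eq h ▸ mem_connectedComponent) hq
      rw [hpq]
  · rw [key h hp]

end Fringe

/-- Path connectedness of all components is the invariant separating the two powers. -/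
theorem nonempty_joined_pi {ι : Type*} {L : Type u} [TopologicalSpace L]
    (hL : ∀ p q : L, q ∈ connectedComponent p → Joined p q) {x y : ι → L}
    (h : y ∈ connectedComponent x) : Joined x y :=
  Joined.pi fun i => hL _ _ <|
    (continuous_apply i).image_connectedComponent_subset x (mem_image_of_mem _ h)

/-! ### The topologist's sine curve -/

/-- The closed topologist's sine curve over `[0, 1]`. -/
def sineCurve : Set (ℝ × ℝ) :=
  {p | p ∈ Icc (0 : ℝ) 1 ×ˢ Icc (-1 : ℝ) 1 ∧ p.1 * p.2 = p.1 * Real.sin p.1⁻¹}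

theorem continuous_mul_sin_inv : Continuous fun x : ℝ => x * Real.sin x⁻¹ := by
  rw [continuous_iff_continuousAt]
  intro x
  rcases eq_or_ne x 0 with rfl | hx
  · have : Tendsto (fun x : ℝ => x * Real.sin x⁻¹) (𝓝 0) (𝓝 0) := by
      refine squeeze_zero_norm (a := fun x => |x|) (fun x => ?_) ?_
      · rw [norm_mul, Real.norm_eq_abs, Real.norm_eq_abs]
        exact mul_le_of_le_one_right (abs_nonneg x) (Real.abs_sin_le_one _)
      · simpa using (continuous_abs (G := ℝ)).tendsto 0
    simpa [ContinuousAt] using this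
  · exact continuousAt_id.mul (Real.continuous_sin.continuousAt.comp (continuousAt_inv₀ hx))

theorem isCompact_sineCurve : IsCompact sineCurve :=
  (isCompact_Icc.prod isCompact_Icc).inter_right
    (isClosed_eq (continuous_fst.mul continuous_snd) (continuous_mul_sin_inv.comp continuous_fst))

instance : CompactSpace sineCurve := isCompact_iff_compactSpace.1 isCompact_sineCurve

/-- The point of the sine curve over `x`; it lies at height zero when `x = 0`. -/
noncomputable def sinePoint (x : Icc (0 : ℝ) 1) : sineCurve :=
  ⟨(x, Real.sin (x : ℝ)⁻¹), ⟨x.2, Real.sin_mem_Icc _⟩, rfl⟩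

theorem sinePoint_mem_connectedComponent :
    sinePoint 1 ∈ connectedComponent (sinePoint 0) := by
  let G : Set sineCurve := sinePoint '' {0}ᶜ
  have hG : IsPreconnected G := by
    have hI : IsPreconnected ({0}ᶜ : Set (Icc (0 : ℝ) 1)) := by
      have : ({0}ᶜ : Set (Icc (0 : ℝ) 1)) = Ioi 0 := by
        ext x
        simp [pos_iff_ne_zero]
      rw [this]
      exact isPreconnected_Ioi
    refine hI.image _ (Topology.IsInducing.subtypeVal.continuousOn_iff.2 ?_)
    refine continuous_subtype_val.continuousOn.prodMk
      (Real.continuous_sin.comp_continuousOn (continuous_subtype_val.continuousOn.inv₀ ?_))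
    intro x hx h
    exact hx (Subtype.ext h)
  have hcl : sinePoint 0 ∈ closure G := by
    -- These are zeros of `sin x⁻¹`. The shift to `n + 1` avoids `0⁻¹ = 0`, which is not in the
    -- index set of `G`.
    let x : ℕ → Icc (0 : ℝ) 1 := fun n => ⟨(((n : ℝ) + 1) * Real.pi)⁻¹, by positivity, by
      refine inv_le_one_of_one_le₀ ?_
      have := Real.pi_gt_three
      have := n.cast_nonneg (α := ℝ)
      nlinarith⟩
    have hx : Tendsto (fun n : ℕ => (((n : ℝ) + 1) * Real.pi)⁻¹) atTop (𝓝 0) :=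
      tendsto_inv_atTop_zero.comp
        ((tendsto_atTop_add_const_right _ 1 tendsto_natCast_atTop_atTop).atTop_mul_const
          Real.pi_pos)
    refine mem_closure_of_tendsto (f := fun n => sinePoint (x n)) (b := atTop) ?_
      (Eventually.of_forall fun n => mem_image_of_mem _ fun h => ?_)
    · rw [tendsto_subtype_rng]
      have hv : ∀ n, ((sinePoint (x n) : sineCurve) : ℝ × ℝ) =
          ((((n : ℝ) + 1) * Real.pi)⁻¹, 0) := fun n => by
        refine Prod.ext rfl ?_
        change Real.sin ((((n : ℝ) + 1) * Real.pi)⁻¹)⁻¹ = 0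
        rw [inv_inv]
        exact_mod_cast Real.sin_nat_mul_pi (n + 1)
      have h0 : ((sinePoint 0 : sineCurve) : ℝ × ℝ) = (0, 0) := by simp [sinePoint]
      simp_rw [hv]
      rw [h0]
      exact hx.prodMk_nhds tendsto_const_nhds
    · have h' : (((n : ℝ) + 1) * Real.pi)⁻¹ = 0 := congrArg Subtype.val h
      have : 0 < (((n : ℝ) + 1) * Real.pi)⁻¹ := by positivity
      exact this.ne' h'
  have hins : IsPreconnected (insert (sinePoint 0) G) :=
    hG.subset_closure (subset_insert _ _) (insert_subset hcl subset_closure)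
  exact hins.subset_connectedComponent (mem_insert _ _)
    (mem_insert_of_mem _ (mem_image_of_mem _ one_ne_zero))

/-- The defining equation carries the factor `p.1`: this keeps it closed and vacuous over `0`, where
the whole segment remains. Elsewhere the factor cancels. -/
theorem sineCurve_snd {p : ℝ × ℝ} (hp : p ∈ sineCurve) (h : p.1 ≠ 0) :
    p.2 = Real.sin p.1⁻¹ :=
  mul_left_cancel₀ h hp.2

/-- The sine curve oscillates near its limit segment, so no path leaves that segment. -/
theorem not_joined_sinePoint : ¬ Joined (sinePoint 0) (sinePoint 1) := by
  rintro ⟨γ⟩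
  let f : ℝ → ℝ := fun t => (γ.extend t : ℝ × ℝ).1
  let g : ℝ → ℝ := fun t => (γ.extend t : ℝ × ℝ).2
  have hγ : Continuous fun t => (γ.extend t : ℝ × ℝ) :=
    continuous_subtype_val.comp γ.continuous_extend
  have hf : Continuous f := continuous_fst.comp hγ
  have hg : Continuous g := continuous_snd.comp hγ
  have hf0 : f 0 = 0 := by simp only [f, γ.extend_zero]; rfl
  have hf1 : f 1 = 1 := by simp only [f, γ.extend_one]; rfl
  have hfn : ∀ t, 0 ≤ f t := fun t => (γ.extend t).2.1.1.1
  have hfg : ∀ t, f t ≠ 0 → g t = Real.sin (f t)⁻¹ := fun t h => sineCurve_snd (γ.extend t).2 h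
  have hTc : IsCompact (Icc (0 : ℝ) 1 ∩ f ⁻¹' {0}) :=
    isCompact_Icc.inter_right (isClosed_singleton.preimage hf)
  -- `s` is the last time at which the path meets the limit segment.
  obtain ⟨s, ⟨⟨hs0, hs1⟩, hfs⟩, hmax⟩ :=
    hTc.exists_isGreatest ⟨0, ⟨le_rfl, zero_le_one⟩, hf0⟩
  have hfs : f s = 0 := hfs
  have hs1 : s < 1 := lt_of_le_of_ne hs1 fun h => by
    rw [h, hf1] at hfs
    exact one_ne_zero hfs
  obtain ⟨δ, hδ, hgδ⟩ := Metric.continuousAt_iff.1 (hg.continuousAt (x := s)) 1 one_pos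
  obtain ⟨t, hst, ht⟩ := exists_between (lt_min hs1 (lt_add_of_pos_right s hδ))
  have ht1 : t < 1 := ht.trans_le (min_le_left _ _)
  have htδ : t < s + δ := ht.trans_le (min_le_right _ _)
  have hft : 0 < f t := lt_of_le_of_ne (hfn t) fun h =>
    not_le.2 hst (hmax ⟨⟨hs0.trans hst.le, ht1.le⟩, h.symm⟩)
  -- By the intermediate value theorem the path passes over every such `v` between `s` and `t`,
  -- where its height stays within `1` of `g s`.
  have hval : ∀ v, 0 < v → v ≤ f t → dist (Real.sin v⁻¹) (g s) < 1 := by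
    intro v hv hvt
    obtain ⟨r, ⟨hr₁, hr₂⟩, rfl⟩ := intermediate_value_Icc hst.le hf.continuousOn
      ⟨hfs ▸ hv.le, hvt⟩
    rw [← hfg r hv.ne']
    refine hgδ ?_
    rw [Real.dist_eq, abs_lt]
    constructor <;> linarith
  obtain ⟨n, hn⟩ := exists_nat_gt (f t)⁻¹
  have hpi := Real.pi_gt_three
  have hn0 := n.cast_nonneg (α := ℝ)
  have hosc : ∀ a : ℝ, 0 ≤ a →
      dist (Real.sin (a + n * (2 * Real.pi))) (g s) < 1 := by
    intro a ha
    have h₁ : (f t)⁻¹ ≤ a + n * (2 * Real.pi) := by nlinarith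
    have h₂ := hval (a + n * (2 * Real.pi))⁻¹
      (inv_pos.2 ((inv_pos.2 hft).trans_le h₁)) (inv_le_of_inv_le₀ hft h₁)
    rwa [inv_inv] at h₂
  -- The heights `1` and `-1` are at distance `2`, so they cannot both be at distance less than `1`
  -- from `g s`.
  have h₁ := hosc (Real.pi / 2) (by positivity)
  have h₂ := hosc (Real.pi / 2 + Real.pi) (by positivity)
  rw [Real.sin_add_nat_mul_two_pi, Real.dist_eq, abs_lt] at h₁ h₂
  rw [Real.sin_add_pi, Real.sin_pi_div_two] at h₂
  rw [Real.sin_pi_div_two] at h₁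
  linarith [h₁.2, h₂.1]

/-! ### The two powers and their sum -/

/-- Two non-reconstructible h-homogeneous compact metrizable spaces whose sum is reconstructible:
the countable powers of compactifications of a countable discrete space with remainder an arc and
a topologist's sine curve, respectively. -/
theorem exists_reconstructible_sum :
    ∃ (Y Z : Type) (_ : TopologicalSpace Y) (_ : TopologicalSpace Z),
      (CompactSpace Y ∧ TopologicalSpace.MetrizableSpace Y ∧ TopRecon.HHomogeneous Y ∧
        ¬ TopRecon.Reconstructible Y ∧ ¬ Nonempty (Y ≃ₜ ↥cantorSet)) ∧
      (CompactSpace Z ∧ TopologicalSpace.MetrizableSpace Z ∧ TopRecon.HHomogeneous Z ∧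
        ¬ TopRecon.Reconstructible Z ∧ ¬ Nonempty (Z ≃ₜ ↥cantorSet)) ∧
      ¬ Nonempty (Y ≃ₜ Z) ∧
      CompactSpace (Y ⊕ Z) ∧ TopologicalSpace.MetrizableSpace (Y ⊕ Z) ∧
      Dense (TopRecon.C₁ (Y ⊕ Z)) ∧ Dense (TopRecon.C₁ (Y ⊕ Z))ᶜ ∧
      IsGδ (TopRecon.C₁ (Y ⊕ Z)) ∧
      TopRecon.Reconstructible (Y ⊕ Z) := by
  have : Nonempty sineCurve := ⟨sinePoint 0⟩
  obtain ⟨c, hc⟩ := TopologicalSpace.exists_dense_seq (Icc (0 : ℝ) 1)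
  obtain ⟨d, hd⟩ := TopologicalSpace.exists_dense_seq sineCurve
  have hc' := dense_isolated_fringe hc
  have hd' := dense_isolated_fringe hd
  have : PathConnectedSpace (Icc (0 : ℝ) 1) :=
    isPathConnected_iff_pathConnectedSpace.1 ((convex_Icc 0 1).isPathConnected ⟨0, by simp⟩)
  have hpc : remainder c 0 ∉ C₁ (fringe c) := by
    refine not_mem_C₁_map (continuous_remainder c) (remainder_injective c) fun h => ?_
    have h1 : (1 : Icc (0 : ℝ) 1) ∈ connectedComponent (0 : Icc (0 : ℝ) 1) := by
      rw [PreconnectedSpace.connectedComponent_eq_univ]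
      exact mem_univ _
    rw [mem_C₁_iff.1 h] at h1
    exact one_ne_zero h1
  have hmem : remainder d (sinePoint 1) ∈ connectedComponent (remainder d (sinePoint 0)) :=
    (continuous_remainder d).image_connectedComponent_subset _
      (mem_image_of_mem _ sinePoint_mem_connectedComponent)
  have hnj : ¬ Joined (remainder d (sinePoint 0)) (remainder d (sinePoint 1)) := fun h =>
    not_joined_sinePoint (h.map (continuous_snd.comp continuous_subtype_val))
  have hpd : remainder d (sinePoint 0) ∉ C₁ (fringe d) := fun h => by
    rw [mem_C₁_iff.1 h] at hmem
    exact hnj (hmem ▸ Joined.refl _)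
  have : Nontrivial (fringe c) := (remainder_injective c).nontrivial
  have : Nontrivial (fringe d) := ⟨remainder d (sinePoint 0), remainder d (sinePoint 1), fun h => hnj (h ▸ Joined.refl _)⟩
  have hYZ : ¬ Nonempty ((ℕ → fringe c) ≃ₜ (ℕ → fringe d)) := by
    rintro ⟨e⟩
    -- Constant sequences carry two unjoined points of one component into the second power. The
    -- homeomorphism would send them to joined points of the first, and mapping back and reading
    -- coordinate `0` would join the original points.
    have hconst : Continuous fun (p : fringe d) (_ : ℕ) => p := continuous_pi fun _ => continuous_id
    have h₁ := (e.symm.continuous.comp hconst).image_connectedComponent_subset _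
      (mem_image_of_mem _ hmem)
    have h₂ := (nonempty_joined_pi (fun _ _ => joined_fringe) h₁).map
      ((continuous_apply 0).comp e.continuous)
    simp only [Function.comp, Homeomorph.apply_symm_apply] at h₂
    exact hnj h₂
  have hCY := dense_C₁_pi hc'
  have hCZ := dense_C₁_pi hd'
  have hCY' := dense_compl_C₁_pi hpc
  have hCZ' := dense_compl_C₁_pi hpd
  have hY := hHomogeneous_pi hc'
  have hZ := hHomogeneous_pi hd'
  obtain ⟨y, hy⟩ := hCY.nonempty
  obtain ⟨z, hz⟩ := hCZ.nonempty
  obtain ⟨y', hy'⟩ := hCY'.nonempty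
  obtain ⟨z', hz'⟩ := hCZ'.nonempty
  have hsum : TopologicalSpace.MetrizableSpace ((ℕ → fringe c) ⊕ (ℕ → fringe d)) :=
    TopologicalSpace.metrizableSpace_of_t3_secondCountable _
  exact ⟨ℕ → fringe c, ℕ → fringe d, inferInstance, inferInstance,
    ⟨inferInstance, inferInstance, hY, not_reconstructible hY hCY,
      not_nonempty_homeomorph_cantorSet hy'⟩,
    ⟨inferInstance, inferInstance, hZ, not_reconstructible hZ hCZ,
      not_nonempty_homeomorph_cantorSet hz'⟩,
    hYZ, inferInstance, hsum,
    dense_sum hCY hCZ (fun _ => inl_mem_C₁) (fun _ => inr_mem_C₁),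
    dense_sum hCY' hCZ' (fun _ h => not_mem_C₁_map continuous_inl Sum.inl_injective h)
      (fun _ h => not_mem_C₁_map continuous_inr Sum.inr_injective h),
    isGδ_C₁, reconstructible_sum hY hZ hy hz hYZ⟩

end TopRecon

theorem lemma6p5 :
    ∃ (Y Z : Type) (_ : TopologicalSpace Y) (_ : TopologicalSpace Z),
      (CompactSpace Y ∧ TopologicalSpace.MetrizableSpace Y ∧ TopRecon.HHomogeneous Y ∧
        ¬ TopRecon.Reconstructible Y ∧ ¬ Nonempty (Y ≃ₜ ↥cantorSet)) ∧
      (CompactSpace Z ∧ TopologicalSpace.MetrizableSpace Z ∧ TopRecon.HHomogeneous Z ∧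
        ¬ TopRecon.Reconstructible Z ∧ ¬ Nonempty (Z ≃ₜ ↥cantorSet)) ∧
      ¬ Nonempty (Y ≃ₜ Z) ∧
      CompactSpace (Y ⊕ Z) ∧ TopologicalSpace.MetrizableSpace (Y ⊕ Z) ∧
      Dense (TopRecon.C₁ (Y ⊕ Z)) ∧ Dense (TopRecon.C₁ (Y ⊕ Z))ᶜ ∧
      IsGδ (TopRecon.C₁ (Y ⊕ Z)) ∧
      TopRecon.Reconstructible (Y ⊕ Z) :=
  TopRecon.exists_reconstructible_sum
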